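/- Let $n \ge 0$ and let $L, C_1, C_2, K_1, K_2$ be real symmetric $n \times n$ matrices such that $C_1, C_2$ are positive definite, $K_1, K_2$ are positive semidefinite, $C_1 K_1 = K_1 C_1$ and $C_2 K_2 = K_2 C_2$. Then there is an $\varepsilon > 0$ such that for every real $z$ with $|z| < \varepsilon$ the matrices $C_1 + zK_1$ and $C_2 - zK_2$ are positive definite (so that their logarithms are defined), and the function $$ f(z) ~=~ \operatorname{tr} \exp\Big( L + \log( C_1 + z K_1 ) + \log( C_2 - z K_2 ) \Big) $$ is concave on $(-\varepsilon, \varepsilon)$. Here $\log$ of a positive definite matrix is its real symmetric logarithm, obtained by applying the natural logarithm to its eigenvalues in an orthonormal eigenbasis. -/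

import Mathlib

/-- The logarithm of a real symmetric matrix, by the functional calculus: `Real.log` is applied to
the eigenvalues in an orthonormal eigenbasis. On positive definite matrices, the only ones on which
it is used, this is the principal matrix logarithm. -/
noncomputable def matrixLog {n : ℕ} (A : Matrix (Fin n) (Fin n) ℝ) : Matrix (Fin n) (Fin n) ℝ :=
  cfc Real.log A

/-! Commutation splits the logarithm: $\log(C_1+tK_1)=\log C_1+\log(1+tP)$ with $P=C_1^{-1}K_1\ge
0$, and likewise with $Q=C_2^{-1}K_2\ge 0$ and $-t$. The exponent at a base point is therefore
$H+D(t)$, where $D(t)=t(P-Q)-\tfrac{t^2}{2}(P^2+Q^2)+O(t^3)$.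

The sharpened Golden–Thompson bound $\operatorname{tr}e^{H+D}\le\operatorname{tr}(e^{H/2}e^{D/2})^2$
is an equality at $D=0$, so it bounds the symmetric second difference of $f$ by that of the right
side. With $G=e^{H/2}$, the $t^2$ coefficient there is
$\tfrac14[\operatorname{tr}(G(P+Q))^2-\operatorname{tr}G^2(P+Q)^2]-\operatorname{tr}(GPGQ)\le 0$.
The usual bound $\operatorname{tr}e^He^D$ would leave $-\tfrac12\operatorname{tr}G^2(PQ+QP)$, which
has no definite sign.

The base point can be moved along the pencil, so the second differences are at most $o(t^2)$
everywhere, and continuity gives concavity. -/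

section TraceExpLog

open Filter Topology Asymptotics
open scoped Matrix Matrix.Norms.L2Operator

/-- A continuous function whose symmetric second differences are at most `o(h ^ 2)` is concave. -/
theorem concaveOn_Ioo_of_second_difference_le {f : ℝ → ℝ} {a b : ℝ}
    (hf : ContinuousOn f (Set.Ioo a b))
    (h : ∀ x ∈ Set.Ioo a b, ∀ δ > 0, ∀ᶠ t in 𝓝 (0 : ℝ),
      f (x + t) + f (x - t) - 2 * f x ≤ δ * t ^ 2) :
    ConcaveOn ℝ (Set.Ioo a b) f := by
  refine LinearOrder.concaveOn_of_lt (convex_Ioo a b) fun x hx y hy hxy α β hα hβ hαβ => ?_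
  by_contra! hlt
  simp only [smul_eq_mul] at hlt
  have hyx : 0 < y - x := sub_pos.2 hxy
  set p := α * x + β * y with hp
  set s := (f y - f x) / (y - x) with hs
  have hpx : p - x = β * (y - x) := by rw [hp]; linear_combination x * hαβ
  have hyp : y - p = α * (y - x) := by rw [hp]; linear_combination y * -hαβ
  have hsy : s * (y - x) = f y - f x := div_mul_cancel₀ _ hyx.ne'
  have hd : 0 < α * f x + β * f y - f p := by linarith
  -- Chosen so that the quadratic bump in `g` uses up only half of the gap at `p`, leaving `g p <
  -- 0`.
  set δ := (α * f x + β * f y - f p) / (2 * (α * β * (y - x) ^ 2)) with hδ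
  have hδ0 : 0 < δ := by positivity
  let g : ℝ → ℝ := fun t => f t - (f x + s * (t - x)) + δ * ((t - x) * (y - t))
  have hsub : Set.Icc x y ⊆ Set.Ioo a b := (convex_Ioo a b).ordConnected.out hx hy
  have hg : ContinuousOn g (Set.Icc x y) :=
    ((hf.mono hsub).sub (by fun_prop)).add (by fun_prop)
  have hgp : g p < 0 := by
    have h1 : δ * ((p - x) * (y - p)) = (α * f x + β * f y - f p) / 2 := by
      rw [hpx, hyp, hδ]; field_simp
    have h2 : s * (p - x) = β * (f y - f x) := by rw [hpx, ← hsy]; ring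
    have h3 : α * f x = f x - β * f x := by linear_combination f x * hαβ
    simp only [g, h1, h2]
    linarith
  have hpm : p ∈ Set.Icc x y := by
    constructor
    · have := mul_pos hβ hyx; linarith
    · have := mul_pos hα hyx; linarith
  obtain ⟨q, hq, hmin⟩ := isCompact_Icc.exists_isMinOn ⟨p, hpm⟩ hg
  have hgq : g q < 0 := (hmin hpm).trans_lt hgp
  have hqx : x < q := hq.1.lt_of_ne fun e => by
    rw [← e] at hgq; simp [g] at hgq
  have hqy : q < y := hq.2.lt_of_ne fun e => by
    rw [e] at hgq; simp only [g] at hgq; rw [hsy] at hgq; simp at hgq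
  have hn : ∀ᶠ t in 𝓝 (0 : ℝ), q + t ∈ Set.Icc x y := by
    have : Tendsto (fun t : ℝ => q + t) (𝓝 0) (𝓝 q) := by
      simpa using! (continuous_const.add continuous_id : Continuous fun t : ℝ => q + t).tendsto 0
    exact this.eventually (Icc_mem_nhds hqx hqy)
  have hn' : ∀ᶠ t in 𝓝 (0 : ℝ), q - t ∈ Set.Icc x y := by
    have : Tendsto (fun t : ℝ => q - t) (𝓝 0) (𝓝 q) := by
      simpa using! (continuous_const.sub continuous_id : Continuous fun t : ℝ => q - t).tendsto 0
    exact this.eventually (Icc_mem_nhds hqx hqy)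
  have hev := (hn.and (hn'.and (h q (hsub hq) δ hδ0)))
  obtain ⟨t, ⟨h1, h2, h3⟩, ht⟩ :=
    ((hev.filter_mono nhdsWithin_le_nhds).and (self_mem_nhdsWithin (a := (0 : ℝ))
      (s := Set.Ioi 0))).exists
  -- Minimality makes the second difference of `g` at `q` nonnegative. The bump contributes
  -- $-2\delta t^2$ to it, so that of `f` is at least $2\delta t^2$, against the bound $\delta t^2$.
  have e1 := hmin h1
  have e2 := hmin h2
  simp only [Set.mem_ofPred_eq, g] at e1 e2
  have e3 : 0 < δ * t ^ 2 := mul_pos hδ0 (pow_pos ht 2)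
  nlinarith

/-! ### Trace inequalities for powers of products -/

section TraceInequalities

variable {m : Type*} [Fintype m]

theorem Matrix.trace_mul_self_le_trace_mul_conjTranspose (T : Matrix m m ℝ) :
    (T * T).trace ≤ (T * Tᴴ).trace := by
  have h := (Matrix.posSemidef_self_mul_conjTranspose (T - Tᴴ)).trace_nonneg
  have h1 : (Tᴴ * Tᴴ).trace = (T * T).trace := by
    rw [← Matrix.conjTranspose_mul, Matrix.trace_conjTranspose]; simp
  have h2 : (Tᴴ * T).trace = (T * Tᴴ).trace := Matrix.trace_mul_comm _ _
  simp only [Matrix.conjTranspose_sub, Matrix.conjTranspose_conjTranspose, mul_sub, sub_mul,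
    Matrix.trace_sub] at h
  linarith

theorem Matrix.trace_mul_le_of_isHermitian {A B : Matrix m m ℝ} (hA : A.IsHermitian)
    (hB : B.IsHermitian) : 2 * (A * B).trace ≤ (A * A).trace + (B * B).trace := by
  have h := (Matrix.posSemidef_self_mul_conjTranspose (A - B)).trace_nonneg
  have h2 : (B * A).trace = (A * B).trace := Matrix.trace_mul_comm _ _
  simp only [Matrix.conjTranspose_sub, hA.eq, hB.eq, mul_sub, sub_mul, Matrix.trace_sub] at h
  linarith

variable [DecidableEq m]

theorem Matrix.trace_mul_pow_comm (A B : Matrix m m ℝ) (k : ℕ) :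
    ((A * B) ^ k).trace = ((B * A) ^ k).trace := by
  cases k with
  | zero => simp
  | succ k =>
    rw [pow_succ, ← mul_assoc, Matrix.trace_mul_comm, ← mul_assoc]
    have : ∀ k : ℕ, B * (A * B) ^ k = (B * A) ^ k * B := fun k => by
      induction k with
      | zero => simp
      | succ k ih => rw [pow_succ, ← mul_assoc, ih, pow_succ]; simp only [mul_assoc]
    rw [this, mul_assoc, ← pow_succ]

/-- Take $T=AB$: then $TT^{\mathsf T}=AB^2A$, and the trace is cyclic. -/
theorem Matrix.IsHermitian.trace_mul_pow_le {A B : Matrix m m ℝ} (hA : A.IsHermitian)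
    (hB : B.IsHermitian) {k : ℕ}
    (h : ∀ T : Matrix m m ℝ, (T ^ 2 ^ (k + 1)).trace ≤ ((T * Tᴴ) ^ 2 ^ k).trace) :
    ((A * B) ^ 2 ^ (k + 1)).trace ≤ ((A ^ 2 * B ^ 2) ^ 2 ^ k).trace := by
  refine (h (A * B)).trans_eq ?_
  rw [Matrix.conjTranspose_mul, hA.eq, hB.eq,
    show A * B * (B * A) = A * (B ^ 2 * A) by simp only [pow_two, mul_assoc],
    Matrix.trace_mul_pow_comm,
    show B ^ 2 * A * A = B ^ 2 * A ^ 2 by simp only [pow_two, mul_assoc],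
    Matrix.trace_mul_pow_comm]

/-- Iterates the squaring step. Weyl's inequality is assumed only for exponents below `k`, so that
its own strong induction can call this lemma. -/
theorem Matrix.IsHermitian.trace_mul_pow_le_trace_pow_mul_pow {k : ℕ}
    (h : ∀ j < k, ∀ T : Matrix m m ℝ, (T ^ 2 ^ (j + 1)).trace ≤ ((T * Tᴴ) ^ 2 ^ j).trace)
    {A B : Matrix m m ℝ} (hA : A.IsHermitian) (hB : B.IsHermitian) :
    ((A * B) ^ 2 ^ k).trace ≤ (A ^ 2 ^ k * B ^ 2 ^ k).trace := by
  induction k generalizing A B with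
  | zero => simp
  | succ k ih =>
    refine (hA.trace_mul_pow_le hB (h k k.lt_succ_self)).trans ?_
    refine (ih (fun j hj => h j (hj.trans k.lt_succ_self)) (hA.pow 2) (hB.pow 2)).trans_eq ?_
    simp only [← pow_mul, ← pow_succ']

/-- Weyl's inequality between the eigenvalues and the singular values of a real matrix, summed
for the exponents that are powers of two. -/
theorem Matrix.trace_pow_two_pow_le (k : ℕ) (T : Matrix m m ℝ) :
    (T ^ 2 ^ (k + 1)).trace ≤ ((T * Tᴴ) ^ 2 ^ k).trace := by
  induction k using Nat.strong_induction_on generalizing T with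
  | _ k ih =>
    cases k with
    | zero => simpa [pow_two] using T.trace_mul_self_le_trace_mul_conjTranspose
    | succ k =>
      have hP := Matrix.isHermitian_conjTranspose_mul_self T
      have hQ := Matrix.isHermitian_mul_conjTranspose_self T
      -- Apply the case `k` to $T^2$. Cyclicity turns the bound into $\operatorname{tr}(T^{\mathsf
      -- T}T\cdot TT^{\mathsf T})^{2^k}$; the factors are separated by `h4` and then by
      -- $2\operatorname{tr}AB\le\operatorname{tr}A^2+\operatorname{tr}B^2$, whose two right-hand
      -- traces agree here.
      have h1 := ih k k.lt_succ_self (T ^ 2)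
      have h2 : (T ^ 2) ^ 2 ^ (k + 1) = T ^ 2 ^ (k + 1 + 1) := by
        rw [← pow_mul, ← pow_succ']
      have h3 : ((T ^ 2 * (T ^ 2)ᴴ) ^ 2 ^ k).trace = ((Tᴴ * T * (T * Tᴴ)) ^ 2 ^ k).trace := by
        rw [show T ^ 2 * (T ^ 2)ᴴ = T * (T * Tᴴ * Tᴴ) by
          simp only [pow_two, Matrix.conjTranspose_mul, mul_assoc], Matrix.trace_mul_pow_comm,
          show T * Tᴴ * Tᴴ * T = T * Tᴴ * (Tᴴ * T) by simp only [mul_assoc],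
          Matrix.trace_mul_pow_comm]
      have h4 := Matrix.IsHermitian.trace_mul_pow_le_trace_pow_mul_pow
        (fun j hj => ih j (hj.trans k.lt_succ_self)) hP hQ
      have h5 := Matrix.trace_mul_le_of_isHermitian (hP.pow (2 ^ k)) (hQ.pow (2 ^ k))
      rw [← pow_add, ← pow_add, ← two_mul, ← pow_succ', Matrix.trace_mul_pow_comm Tᴴ T] at h5
      rw [h2, h3] at h1
      linarith

end TraceInequalities

/-! ### The Lie product formula -/

section ExpSmul

variable {𝔸 : Type*} [NormedRing 𝔸] [NormedAlgebra ℝ 𝔸] [CompleteSpace 𝔸]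

theorem hasDerivAt_exp_smul_zero (a : 𝔸) :
    HasDerivAt (fun t : ℝ => NormedSpace.exp (t • a)) a 0 := by
  simpa using hasDerivAt_exp_smul_const (𝕂 := ℝ) a (0 : ℝ)

theorem exp_inv_smul_pow (a : 𝔸) {n : ℕ} (hn : n ≠ 0) :
    NormedSpace.exp ((n : ℝ)⁻¹ • a) ^ n = NormedSpace.exp a := by
  let +nondep : NormedAlgebra ℚ 𝔸 := .restrictScalars ℚ ℝ 𝔸
  rw [← NormedSpace.exp_nsmul, ← Nat.cast_smul_eq_nsmul ℝ, smul_smul, mul_inv_cancel₀ (by simpa),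
    one_smul]

end ExpSmul

section Trotter

variable {𝔸 : Type*} [NormedRing 𝔸] [NormOneClass 𝔸]

theorem norm_pow_sub_pow_le_of_norm_le {u v : 𝔸} {M : ℝ} (hM : 1 ≤ M) (hu : ‖u‖ ≤ M)
    (hv : ‖v‖ ≤ M) (n : ℕ) : ‖u ^ n - v ^ n‖ ≤ n * ‖u - v‖ * M ^ n := by
  induction n with
  | zero => simp
  | succ n ih =>
    have hM0 : 0 ≤ M := zero_le_one.trans hM
    have h : u ^ (n + 1) - v ^ (n + 1) = u ^ n * (u - v) + (u ^ n - v ^ n) * v := by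
      rw [pow_succ, pow_succ]; noncomm_ring
    have h1 : ‖u ^ n * (u - v)‖ ≤ M ^ (n + 1) * ‖u - v‖ := by
      refine (norm_mul_le _ _).trans (mul_le_mul_of_nonneg_right ?_ (norm_nonneg _))
      exact (norm_pow_le u n).trans ((pow_le_pow_left₀ (norm_nonneg _) hu n).trans
        (pow_le_pow_right₀ hM n.le_succ))
    have h2 : ‖(u ^ n - v ^ n) * v‖ ≤ n * ‖u - v‖ * M ^ n * M :=
      (norm_mul_le _ _).trans (mul_le_mul ih hv (norm_nonneg _) (by positivity))
    rw [h]
    refine (norm_add_le _ _).trans ((add_le_add h1 h2).trans_eq ?_)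
    push_cast
    ring

variable [NormedAlgebra ℝ 𝔸]

theorem eventually_norm_pow_le_of_hasDerivAt {u : ℝ → 𝔸} {u' : 𝔸} (hu : HasDerivAt u u' 0)
    (hu0 : u 0 = 1) : ∃ C : ℝ, ∀ᶠ n : ℕ in atTop, ‖u (n : ℝ)⁻¹‖ ≤ Real.exp (C / n) := by
  obtain ⟨C, hC⟩ := hu.isBigO_sub.bound
  refine ⟨C, ?_⟩
  filter_upwards [tendsto_inv_atTop_nhds_zero_nat.eventually hC] with n hn
  have h : ‖u (n : ℝ)⁻¹‖ ≤ ‖u (n : ℝ)⁻¹ - u 0‖ + ‖u 0‖ := by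
    simpa using norm_add_le (u (n : ℝ)⁻¹ - u 0) (u 0)
  rw [hu0, norm_one] at h
  rw [hu0, sub_zero, norm_inv, Real.norm_natCast, ← div_eq_mul_inv] at hn
  linarith [Real.add_one_le_exp (C / n)]

/-- Equal derivatives give $\|u(1/n)-v(1/n)\|=o(1/n)$. Telescoping costs a factor $n$ and the
bounded factor $(e^{E/n})^n=e^E$. -/
theorem tendsto_pow_sub_pow_of_hasDerivAt {u v : ℝ → 𝔸} {a : 𝔸} (hu : HasDerivAt u a 0)
    (hv : HasDerivAt v a 0) (hu0 : u 0 = 1) (hv0 : v 0 = 1) :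
    Tendsto (fun n : ℕ => u (n : ℝ)⁻¹ ^ n - v (n : ℝ)⁻¹ ^ n) atTop (𝓝 0) := by
  obtain ⟨C, hC⟩ := eventually_norm_pow_le_of_hasDerivAt hu hu0
  obtain ⟨D, hD⟩ := eventually_norm_pow_le_of_hasDerivAt hv hv0
  set E := max 0 (max C D)
  have hd : Tendsto (fun n : ℕ => (n : ℝ) * ‖u (n : ℝ)⁻¹ - v (n : ℝ)⁻¹‖) atTop (𝓝 0) := by
    have h := (hasDerivAt_iff_isLittleO.1 (hu.sub hv)).comp_tendsto tendsto_inv_atTop_nhds_zero_nat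
    have h' := h.norm_norm.tendsto_div_nhds_zero
    refine h'.congr fun n => ?_
    simp [hu0, hv0, div_eq_mul_inv, mul_comm]
  have hd' := hd.mul_const (Real.exp E)
  rw [zero_mul] at hd'
  refine squeeze_zero_norm' ?_ hd'
  filter_upwards [hC, hD, eventually_gt_atTop 0] with n hn hn' hn0
  have hn0' : (0 : ℝ) < n := by exact_mod_cast hn0
  have h := norm_pow_sub_pow_le_of_norm_le (M := Real.exp (E / n))
    (Real.one_le_exp (div_nonneg (le_max_left _ _) hn0'.le))
    (hn.trans (Real.exp_le_exp.2 (div_le_div_of_nonneg_right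
      ((le_max_left _ _).trans (le_max_right _ _)) hn0'.le)))
    (hn'.trans (Real.exp_le_exp.2 (div_le_div_of_nonneg_right
      ((le_max_right _ _).trans (le_max_right _ _)) hn0'.le))) n
  rwa [← Real.exp_nat_mul, mul_div_cancel₀ _ hn0'.ne'] at h

variable [CompleteSpace 𝔸]

/-- The Lie product formula. -/
theorem tendsto_exp_mul_exp_pow (a b : 𝔸) :
    Tendsto (fun n : ℕ => (NormedSpace.exp ((n : ℝ)⁻¹ • a) * NormedSpace.exp ((n : ℝ)⁻¹ • b)) ^ n)
      atTop (𝓝 (NormedSpace.exp (a + b))) := by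
  have h := tendsto_pow_sub_pow_of_hasDerivAt
    (u := fun t : ℝ => NormedSpace.exp (t • a) * NormedSpace.exp (t • b))
    (v := fun t : ℝ => NormedSpace.exp (t • (a + b))) (a := a + b)
    (by simpa using! (hasDerivAt_exp_smul_zero a).mul (hasDerivAt_exp_smul_zero b))
    (hasDerivAt_exp_smul_zero _) (by simp) (by simp)
  have h' := h.add_const (NormedSpace.exp (a + b))
  rw [zero_add] at h'
  refine h'.congr' ?_
  filter_upwards [eventually_ne_atTop 0] with n hn
  rw [exp_inv_smul_pow (a + b) hn, sub_add_cancel]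

end Trotter

/-! ### Golden–Thompson -/

section GoldenThompson

variable {m : Type*} [Fintype m] [DecidableEq m]

theorem Matrix.IsHermitian.exp_smul {A : Matrix m m ℝ} (hA : A.IsHermitian) (t : ℝ) :
    (NormedSpace.exp (t • A)).IsHermitian :=
  Matrix.IsHermitian.exp (by rw [Matrix.IsHermitian, Matrix.conjTranspose_smul, hA.eq, star_trivial])

theorem Matrix.exp_smul_pow_two (A : Matrix m m ℝ) (t : ℝ) :
    NormedSpace.exp (t • A) ^ 2 = NormedSpace.exp ((2 * t) • A) := by
  rw [← Matrix.exp_nsmul, ← Nat.cast_smul_eq_nsmul ℝ, smul_smul, Nat.cast_ofNat]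

/-- Halving the Lie product step is the inequality
$\operatorname{tr}(AB)^{2^{k+1}}\le\operatorname{tr}(A^2B^2)^{2^k}$. -/
theorem Matrix.IsHermitian.trace_exp_mul_exp_pow_antitone {A B : Matrix m m ℝ}
    (hA : A.IsHermitian) (hB : B.IsHermitian) :
    Antitone fun k : ℕ => ((NormedSpace.exp (((2 ^ k : ℕ) : ℝ)⁻¹ • A) *
      NormedSpace.exp (((2 ^ k : ℕ) : ℝ)⁻¹ • B)) ^ 2 ^ k).trace := by
  refine antitone_nat_of_succ_le fun k => ?_
  refine ((hA.exp_smul _).trace_mul_pow_le (hB.exp_smul _)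
    (Matrix.trace_pow_two_pow_le k)).trans_eq ?_
  have h : (2 : ℝ) * ((2 ^ (k + 1) : ℕ) : ℝ)⁻¹ = ((2 ^ k : ℕ) : ℝ)⁻¹ := by
    push_cast; rw [pow_succ]; field_simp
  rw [Matrix.exp_smul_pow_two, Matrix.exp_smul_pow_two, h]

/-- A sharpened form of the Golden–Thompson inequality. -/
theorem Matrix.IsHermitian.trace_exp_add_le {A B : Matrix m m ℝ}
    (hA : A.IsHermitian) (hB : B.IsHermitian) :
    (NormedSpace.exp (A + B)).trace ≤ ((NormedSpace.exp ((2 : ℝ)⁻¹ • A) *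
      NormedSpace.exp ((2 : ℝ)⁻¹ • B)) ^ 2).trace := by
  -- The Lie product formula needs $\|1\|=1$, which fails for empty matrices.
  cases isEmpty_or_nonempty m with
  | inl h => simp [Matrix.trace]
  | inr h =>
    have ht := (tendsto_exp_mul_exp_pow A B).comp (tendsto_pow_atTop_atTop_of_one_lt one_lt_two)
    have ht' := ((continuous_id.matrix_trace).tendsto _).comp ht
    -- Index 0 would give the usual Golden–Thompson inequality; index 1 is the sharper bound.
    have := (hA.trace_exp_mul_exp_pow_antitone hB).le_of_tendsto ht' 1
    simpa using this

end GoldenThompson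

/-! ### Logarithms along a commuting direction -/

section Log

open scoped MatrixOrder

variable {m : Type*} [Fintype m] [DecidableEq m]

theorem abs_log_one_add_sub_le {x : ℝ} (hx : |x| ≤ 1 / 2) :
    |Real.log (1 + x) - (x - x ^ 2 / 2)| ≤ 2 * |x| ^ 3 := by
  have h := Real.abs_log_sub_add_sum_range_le (x := -x) (by rw [abs_neg]; linarith) 2
  have h1 : |x| ^ (2 + 1) / (1 - |x|) ≤ 2 * |x| ^ 3 := by
    rw [div_le_iff₀ (by linarith), show 2 + 1 = 3 from rfl]
    nlinarith [mul_nonneg (pow_nonneg (abs_nonneg x) 3) (show 0 ≤ 1 - 2 * |x| by linarith)]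
  rw [abs_neg] at h
  refine le_trans (le_of_eq ?_) (h.trans h1)
  congr 1
  simp [Finset.sum_range_succ]
  ring

theorem Matrix.PosDef.exp_of_isHermitian {A : Matrix m m ℝ} (hA : A.IsHermitian) :
    (NormedSpace.exp A).PosDef :=
  (Matrix.nonneg_iff_posSemidef.1 (IsSelfAdjoint.exp_nonneg hA)).posDef_iff_isUnit.2
    (Matrix.isUnit_exp A)

theorem Matrix.PosSemidef.mul_of_commute {A B : Matrix m m ℝ} (hA : A.PosSemidef)
    (hB : B.PosSemidef) (h : Commute A B) : (A * B).PosSemidef :=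
  Matrix.nonneg_iff_posSemidef.1 (Commute.mul_nonneg (Matrix.nonneg_iff_posSemidef.2 hA)
    (Matrix.nonneg_iff_posSemidef.2 hB) h)

theorem eventually_abs_mul_spectrum_le (P : Matrix m m ℝ) :
    ∀ᶠ t in 𝓝 (0 : ℝ), ∀ x ∈ spectrum ℝ P,
      |t * x| ≤ |t| * (‖P‖ * ‖(1 : Matrix m m ℝ)‖) ∧ |t * x| ≤ 1 / 2 := by
  have h : Tendsto (fun t : ℝ => |t| * (‖P‖ * ‖(1 : Matrix m m ℝ)‖)) (𝓝 0) (𝓝 0) := by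
    have : Continuous fun t : ℝ => |t| * (‖P‖ * ‖(1 : Matrix m m ℝ)‖) := by fun_prop
    simpa using this.tendsto 0
  filter_upwards [h.eventually_le_const (show (0 : ℝ) < 1 / 2 by norm_num)] with t ht x hx
  have hx' : |t * x| ≤ |t| * (‖P‖ * ‖(1 : Matrix m m ℝ)‖) := by
    rw [abs_mul]
    exact mul_le_mul_of_nonneg_left (spectrum.norm_le_norm_mul_of_mem hx) (abs_nonneg t)
  exact ⟨hx', hx'.trans ht⟩

/-- The logarithm of `1 + t • P` to second order. -/
theorem cfc_log_one_add_mul_sub_isBigO {P : Matrix m m ℝ} (hP : P.IsHermitian) :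
    (fun t : ℝ => cfc (fun x => Real.log (1 + t * x)) P - (t • P - (t ^ 2 / 2) • (P * P)))
      =O[𝓝 0] fun t => t ^ 3 := by
  have hP' : IsSelfAdjoint P := hP
  refine IsBigO.of_bound (2 * (‖P‖ * ‖(1 : Matrix m m ℝ)‖) ^ 3) ?_
  filter_upwards [eventually_abs_mul_spectrum_le P] with t ht
  have hcont : ContinuousOn (fun x => Real.log (1 + t * x)) (spectrum ℝ P) := by
    refine ContinuousOn.log (by fun_prop) fun x hx => ?_
    have := abs_le.1 (ht x hx).2
    linarith
  have hpoly : cfc (fun x : ℝ => t * x - t ^ 2 / 2 * x ^ 2) P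
      = t • P - (t ^ 2 / 2) • (P * P) := by
    rw [cfc_sub _ _ P, cfc_const_mul _ _ P, cfc_const_mul _ _ P, cfc_pow_id P 2, cfc_id' ℝ P,
      pow_two P]
  rw [← hpoly, ← cfc_sub _ _ P]
  refine norm_cfc_le (by positivity) fun x hx => ?_
  have h := abs_log_one_add_sub_le (ht x hx).2
  rw [Real.norm_eq_abs, Real.norm_eq_abs,
    show t * x - t ^ 2 / 2 * x ^ 2 = t * x - (t * x) ^ 2 / 2 by ring]
  refine h.trans ?_
  have h3 := pow_le_pow_left₀ (abs_nonneg _) (ht x hx).1 3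
  rw [abs_pow]
  rw [mul_pow] at h3
  linarith

theorem eventually_exp_cfc_log_one_add_mul {P : Matrix m m ℝ} (hP : P.IsHermitian) :
    ∀ᶠ t in 𝓝 (0 : ℝ),
      NormedSpace.exp (cfc (fun x => Real.log (1 + t * x)) P) = 1 + t • P := by
  have hP' : IsSelfAdjoint P := hP
  filter_upwards [eventually_abs_mul_spectrum_le P] with t ht
  have hpos : ∀ x ∈ spectrum ℝ P, 0 < 1 + t * x := fun x hx => by
    have := abs_le.1 (ht x hx).2
    linarith
  have hcont : ContinuousOn (fun x => Real.log (1 + t * x)) (spectrum ℝ P) :=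
    ContinuousOn.log (by fun_prop) fun x hx => (hpos x hx).ne'
  rw [← CFC.real_exp_eq_normedSpace_exp (cfc_predicate _ P), ← cfc_comp' Real.exp _ P,
    cfc_congr (g := fun x => 1 + t * x) fun x hx => Real.exp_log (hpos x hx),
    cfc_const_add _ _ P, cfc_const_mul _ _ P, cfc_id' ℝ P, map_one]

variable {n : ℕ}

theorem isHermitian_matrixLog (A : Matrix (Fin n) (Fin n) ℝ) : (matrixLog A).IsHermitian :=
  cfc_predicate (R := ℝ) (p := IsSelfAdjoint) Real.log A

theorem Matrix.PosDef.exp_matrixLog {A : Matrix (Fin n) (Fin n) ℝ} (hA : A.PosDef) :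
    NormedSpace.exp (matrixLog A) = A :=
  CFC.exp_log A (Matrix.isStrictlyPositive_iff_posDef.2 hA)

theorem matrixLog_exp {A : Matrix (Fin n) (Fin n) ℝ} (hA : A.IsHermitian) :
    matrixLog (NormedSpace.exp A) = A :=
  CFC.log_exp A hA

theorem isHermitian_inv_mul_of_commute {M K : Matrix (Fin n) (Fin n) ℝ} (hM : M.IsHermitian)
    (hK : K.IsHermitian) (h : Commute M⁻¹ K) : (M⁻¹ * K).IsHermitian := by
  rw [Matrix.IsHermitian, Matrix.conjTranspose_mul, hK.eq, hM.inv.eq, h.eq]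

theorem Matrix.commute_inv_left {M K : Matrix m m ℝ} (hM : IsUnit M) (h : Commute M K) :
    Commute M⁻¹ K := by
  have hd := (Matrix.isUnit_iff_isUnit_det _).1 hM
  calc M⁻¹ * K = M⁻¹ * (K * M) * M⁻¹ := by
        rw [mul_assoc, mul_assoc, Matrix.mul_nonsing_inv _ hd, mul_one]
    _ = K * M⁻¹ := by rw [← h.eq, Matrix.nonsing_inv_mul_cancel_left _ _ hd]

/-- Along a commuting direction `K`, the matrices `M + t • K` are positive definite for small `t`,
and their logarithm splits off the logarithm of `M`. -/
theorem Matrix.PosDef.eventually_matrixLog_add_smul {M K : Matrix (Fin n) (Fin n) ℝ}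
    (hM : M.PosDef) (hK : K.IsHermitian) (h : Commute M K) :
    ∀ᶠ t in 𝓝 (0 : ℝ), (M + t • K).PosDef ∧ matrixLog (M + t • K) =
      matrixLog M + cfc (fun x => Real.log (1 + t * x)) (M⁻¹ * K) := by
  have hu : IsUnit M := hM.isUnit
  have hc : Commute M⁻¹ K := Matrix.commute_inv_left hu h
  have hP := isHermitian_inv_mul_of_commute hM.isHermitian hK hc
  filter_upwards [eventually_exp_cfc_log_one_add_mul hP] with t ht
  set S := cfc (fun x => Real.log (1 + t * x)) (M⁻¹ * K)
  have hS : S.IsHermitian := cfc_predicate (R := ℝ) (p := IsSelfAdjoint) _ _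
  have hMP : Commute M (M⁻¹ * K) :=
    (Matrix.commute_inv_left hu (Commute.refl M)).symm.mul_right h
  have hMS : Commute (matrixLog M) S :=
    (hMP.cfc_real Real.log).symm.cfc_real _ |>.symm
  -- The splitting is checked after exponentiation, where it reads $M(1+tM^{-1}K)=M+tK$; positivity
  -- then comes from being an exponential.
  have he : NormedSpace.exp (matrixLog M + S) = M + t • K := by
    rw [Matrix.exp_add_of_commute _ _ hMS, hM.exp_matrixLog, ht, mul_add, mul_one,
      Matrix.mul_smul, Matrix.mul_nonsing_inv_cancel_left _ _ ((Matrix.isUnit_iff_isUnit_det _).1 hu)]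
  have hH : (matrixLog M + S).IsHermitian := (isHermitian_matrixLog M).add hS
  rw [← he, matrixLog_exp hH]
  exact ⟨Matrix.PosDef.exp_of_isHermitian hH, rfl⟩

end Log

/-! ### Second-order expansions -/

section SecondOrder

theorem exp_sub_isBigO {𝔸 : Type*} [NormedRing 𝔸] [NormedAlgebra ℝ 𝔸] [CompleteSpace 𝔸] :
    (fun y : 𝔸 => NormedSpace.exp y - (1 + y + (2 : ℝ)⁻¹ • (y * y))) =O[𝓝 0] fun y => ‖y‖ ^ 3 := by
  have h := (NormedSpace.exp_hasFPowerSeriesAt_zero (𝕂 := ℝ)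
    (𝔸 := 𝔸)).isBigO_sub_partialSum_pow 3
  refine h.congr_left fun y => ?_
  simp [FormalMultilinearSeries.partialSum, Finset.sum_range_succ, NormedSpace.expSeries_apply_eq,
    pow_two]

/-- The exponential of `t • X + t ^ 2 • W + o(t ^ 2)` to second order. -/
theorem exp_sub_isLittleO {𝔸 : Type*} [NormedRing 𝔸] [NormedAlgebra ℝ 𝔸] [CompleteSpace 𝔸]
    {D : ℝ → 𝔸} {X W : 𝔸}
    (hD : (fun t => D t - (t • X + t ^ 2 • W)) =o[𝓝 0] fun t : ℝ => t ^ 2) :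
    (fun t => NormedSpace.exp (D t) - (1 + t • X + t ^ 2 • (W + (2 : ℝ)⁻¹ • (X * X))))
      =o[𝓝 0] fun t : ℝ => t ^ 2 := by
  have h21 : (fun t : ℝ => t ^ 2) =O[𝓝 0] fun t : ℝ => t := by
    simpa using (isLittleO_pow_pow (𝕜 := ℝ) one_lt_two).isBigO
  have hW : (fun t : ℝ => t ^ 2 • W) =O[𝓝 0] fun t : ℝ => t ^ 2 := by
    exact IsBigO.of_bound ‖W‖ (Eventually.of_forall fun t => by rw [norm_smul, mul_comm])
  have hX : (fun t : ℝ => t • X) =O[𝓝 0] fun t : ℝ => t := by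
    exact IsBigO.of_bound ‖X‖ (Eventually.of_forall fun t => by rw [norm_smul, mul_comm])
  have hDX : (fun t => D t - t • X) =O[𝓝 0] fun t : ℝ => t ^ 2 :=
    (hD.isBigO.add hW).congr_left fun t => by abel
  have hD1 : D =O[𝓝 0] fun t : ℝ => t :=
    ((hDX.trans h21).add hX).congr_left fun t => by abel
  have hD0 : Tendsto D (𝓝 0) (𝓝 0) := hD1.trans_tendsto tendsto_id
  have h1 : (fun t => NormedSpace.exp (D t) - (1 + D t + (2 : ℝ)⁻¹ • (D t * D t)))
      =o[𝓝 0] fun t : ℝ => t ^ 2 :=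
    ((exp_sub_isBigO.comp_tendsto hD0).trans (hD1.norm_left.pow 3)).trans_isLittleO
      (isLittleO_pow_pow (by norm_num))
  have h32 : (fun t : ℝ => t ^ 3) =o[𝓝 0] fun t : ℝ => t ^ 2 := isLittleO_pow_pow (by norm_num)
  have h2 : (fun t => D t * D t - (t • X) * (t • X)) =o[𝓝 0] fun t : ℝ => t ^ 2 := by
    have ha := (hD1.mul hDX).add ((hDX.mul hX).congr_right fun t => mul_comm _ _)
    refine ((ha.congr_right fun t => ?_).trans_isLittleO h32).congr_left fun t => ?_
    · exact (pow_succ' t 2).symm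
    · simp only [mul_sub, sub_mul]; abel
  refine ((h1.add hD).add (h2.const_smul_left (2 : ℝ)⁻¹)).congr_left fun t => ?_
  simp only [Pi.smul_apply, smul_mul_assoc, mul_smul_comm, smul_smul, smul_sub, smul_add]
  rw [show t ^ 2 * (2 : ℝ)⁻¹ = (2 : ℝ)⁻¹ * (t * t) by ring]
  abel

end SecondOrder

section TraceExpansion

variable {m : Type*} [Fintype m] [DecidableEq m]

open scoped MatrixOrder in
theorem Matrix.PosSemidef.trace_mul_nonneg {A B : Matrix m m ℝ} (hA : A.PosSemidef)
    (hB : B.PosSemidef) : 0 ≤ (A * B).trace := by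
  obtain ⟨S, rfl⟩ := CStarAlgebra.nonneg_iff_eq_star_mul_self.1 (Matrix.nonneg_iff_posSemidef.2 hB)
  rw [Matrix.star_eq_conjTranspose, ← mul_assoc, Matrix.trace_mul_comm, ← mul_assoc]
  exact (hA.mul_mul_conjTranspose_same S).trace_nonneg

theorem Matrix.trace_isLittleO {R : ℝ → Matrix m m ℝ} {g : ℝ → ℝ} (h : R =o[𝓝 0] g) :
    (fun t => (R t).trace) =o[𝓝 0] g :=
  ((LinearMap.toContinuousLinearMap (Matrix.traceLinearMap m ℝ ℝ)).isBigO_comp R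
    (𝓝 0)).trans_isLittleO h

/-- If `E t` agrees to second order with `1 + t • U + t ^ 2 • V`, then the sign of the second
coefficient of `t ↦ tr (G E(t) G E(t))` bounds its symmetric second difference. -/
theorem eventually_trace_sq_add_trace_sq_le {G U V : Matrix m m ℝ} {E : ℝ → Matrix m m ℝ}
    (hE : (fun t => E t - (1 + t • U + t ^ 2 • V)) =o[𝓝 0] fun t : ℝ => t ^ 2)
    (hc : 2 * (G * (G * V)).trace + (G * U * (G * U)).trace ≤ 0) {δ : ℝ} (hδ : 0 < δ) :
    ∀ᶠ t in 𝓝 (0 : ℝ), ((G * E t) ^ 2).trace + ((G * E (-t)) ^ 2).trace - 2 * (G * G).trace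
      ≤ δ * t ^ 2 := by
  set J : ℝ → Matrix m m ℝ := fun t => G + t • (G * U) + t ^ 2 • (G * V) with hJ
  have hJ1 : J =O[𝓝 0] fun _ => (1 : ℝ) :=
    ((show Continuous J by fun_prop).tendsto 0).isBigO_one ℝ
  have hR : (fun t => G * E t - J t) =o[𝓝 0] fun t : ℝ => t ^ 2 := by
    have h := (isBigO_const_const G (one_ne_zero (α := ℝ)) (𝓝 (0 : ℝ))).mul_isLittleO hE
    refine (h.congr_left fun t => ?_).congr_right fun t => one_mul _
    simp only [hJ, mul_sub, mul_add, mul_one, Matrix.mul_smul]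
  have h20 : (fun t : ℝ => t ^ 2) =O[𝓝 0] fun _ => (1 : ℝ) :=
    ((continuous_pow 2).tendsto (0 : ℝ)).isBigO_one ℝ
  have hE1 : (fun t => G * E t) =O[𝓝 0] fun _ => (1 : ℝ) :=
    ((hR.isBigO.trans h20).add hJ1).congr_left fun t => by abel
  have hS : (fun t => ((G * E t) ^ 2).trace - (J t ^ 2).trace) =o[𝓝 0] fun t : ℝ => t ^ 2 := by
    -- $X^2-Y^2=X(X-Y)+(X-Y)Y$ with $X=GE(t)$ and $Y=J(t)$.
    have h := ((hE1.mul_isLittleO hR).congr_right fun t => one_mul _).add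
      ((hR.mul_isBigO hJ1).congr_right fun t => mul_one _)
    refine (Matrix.trace_isLittleO h).congr_left fun t => ?_
    rw [← Matrix.trace_sub]
    congr 1
    simp only [pow_two, mul_sub, sub_mul]
    abel
  have hneg : Tendsto (fun t : ℝ => -t) (𝓝 0) (𝓝 0) := by simpa using (continuous_neg.tendsto (0 : ℝ))
  have hS' : (fun t => ((G * E (-t)) ^ 2).trace - (J (-t) ^ 2).trace) =o[𝓝 0]
      fun t : ℝ => t ^ 2 := (hS.comp_tendsto hneg).congr_right fun t => by simp
  have h4 : (fun t : ℝ => 2 * (G * V * (G * V)).trace * t ^ 4) =o[𝓝 0] fun t : ℝ => t ^ 2 :=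
    (isLittleO_pow_pow (by norm_num)).const_mul_left _
  filter_upwards [((hS.add hS').add h4).bound hδ] with t ht
  -- Odd powers of $t$ cancel between $t$ and $-t$.
  have hJt : (J t ^ 2).trace + (J (-t) ^ 2).trace = 2 * (G * G).trace
      + t ^ 2 * (2 * (2 * (G * (G * V)).trace + (G * U * (G * U)).trace))
      + 2 * (G * V * (G * V)).trace * t ^ 4 := by
    have h1 : (G * V * G).trace = (G * (G * V)).trace := Matrix.trace_mul_comm _ _
    simp only [hJ, pow_two, mul_add, add_mul, Matrix.trace_add, Matrix.mul_smul, Matrix.smul_mul,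
      Matrix.trace_smul, smul_eq_mul, h1]
    ring
  rw [Real.norm_eq_abs, Real.norm_eq_abs, abs_of_nonneg (sq_nonneg t)] at ht
  have := (abs_le.1 ht).2
  nlinarith [mul_nonneg (sq_nonneg t) (neg_nonneg.2 hc)]

/-- With $U=\tfrac12(P-Q)$, the matrix multiplying $G^2$ collapses to $2V=-\tfrac14(P+Q)^2$. Writing
$\operatorname{tr}(G(P-Q))^2=\operatorname{tr}(G(P+Q))^2-4\operatorname{tr}(GPGQ)$ reduces the claim
to $\operatorname{tr}T^2\le\operatorname{tr}TT^{\mathsf T}$ for $T=G(P+Q)$ and to $GPG\ge 0$. -/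
theorem trace_second_coefficient_nonpos {G P Q : Matrix m m ℝ} (hG : G.IsHermitian)
    (hP : P.PosSemidef) (hQ : Q.PosSemidef) :
    2 * (G * (G * ((2 : ℝ)⁻¹ • -((2 : ℝ)⁻¹ • (P * P + Q * Q)) +
        (2 : ℝ)⁻¹ • ((2 : ℝ)⁻¹ • (P - Q) * (2 : ℝ)⁻¹ • (P - Q))))).trace +
      (G * (2 : ℝ)⁻¹ • (P - Q) * (G * (2 : ℝ)⁻¹ • (P - Q))).trace ≤ 0 := by
  have hPQ : 0 ≤ (G * P * (G * Q)).trace := by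
    have h := (hP.conjTranspose_mul_mul_same G).trace_mul_nonneg hQ
    rwa [hG.eq, mul_assoc] at h
  have h1 := Matrix.trace_mul_self_le_trace_mul_conjTranspose (G * (P + Q))
  rw [Matrix.conjTranspose_mul, hG.eq, (hP.isHermitian.add hQ.isHermitian).eq] at h1
  have h2 : (G * (P + Q) * ((P + Q) * G)).trace = (G * (G * ((P + Q) * (P + Q)))).trace := by
    rw [← mul_assoc, Matrix.trace_mul_comm, mul_assoc]
  have h3 : (G * Q * (G * P)).trace = (G * P * (G * Q)).trace := Matrix.trace_mul_comm _ _
  rw [h2] at h1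
  simp only [mul_add, add_mul, mul_sub, sub_mul, smul_add, smul_sub, smul_neg, mul_neg,
    Matrix.trace_add, Matrix.trace_sub, Matrix.trace_neg, Matrix.mul_smul, Matrix.smul_mul,
    Matrix.trace_smul, smul_eq_mul, h3] at h1 ⊢
  linarith

end TraceExpansion

/-! ### Concavity along the pencil -/

section TraceExp

variable {n : ℕ}

theorem eventually_posDef_pencil {C₁ C₂ K₁ K₂ : Matrix (Fin n) (Fin n) ℝ} (hC₁ : C₁.PosDef)
    (hC₂ : C₂.PosDef) (hK₁ : K₁.PosSemidef) (hK₂ : K₂.PosSemidef) (hcomm₁ : Commute C₁ K₁)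
    (hcomm₂ : Commute C₂ K₂) :
    ∀ᶠ z in 𝓝 (0 : ℝ), (C₁ + z • K₁).PosDef ∧ (C₂ - z • K₂).PosDef := by
  filter_upwards [hC₁.eventually_matrixLog_add_smul hK₁.isHermitian hcomm₁,
    hC₂.eventually_matrixLog_add_smul hK₂.isHermitian.neg hcomm₂.neg_right] with z h1 h2
  refine ⟨h1.1, ?_⟩
  simpa [sub_eq_add_neg] using h2.1

/-- The trace of the exponential is continuous along the pencil and its symmetric second
differences at the base point are at most `o(t ^ 2)`. -/
theorem trace_exp_local_bound {L C₁ C₂ K₁ K₂ : Matrix (Fin n) (Fin n) ℝ} (hL : L.IsHermitian)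
    (hC₁ : C₁.PosDef) (hC₂ : C₂.PosDef) (hK₁ : K₁.PosSemidef) (hK₂ : K₂.PosSemidef)
    (hcomm₁ : Commute C₁ K₁) (hcomm₂ : Commute C₂ K₂) {f : ℝ → ℝ}
    (hf : ∀ t, f t = (NormedSpace.exp
      (L + matrixLog (C₁ + t • K₁) + matrixLog (C₂ - t • K₂))).trace) :
    ContinuousAt f 0 ∧ ∀ δ > 0, ∀ᶠ t in 𝓝 (0 : ℝ), f t + f (-t) - 2 * f 0 ≤ δ * t ^ 2 := by
  have hc₁ := Matrix.commute_inv_left hC₁.isUnit hcomm₁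
  have hc₂ := Matrix.commute_inv_left hC₂.isUnit hcomm₂
  set P := C₁⁻¹ * K₁ with hPdef
  set Q := C₂⁻¹ * K₂ with hQdef
  have hP : P.PosSemidef := hC₁.posSemidef.inv.mul_of_commute hK₁ hc₁
  have hQ : Q.PosSemidef := hC₂.posSemidef.inv.mul_of_commute hK₂ hc₂
  set D : ℝ → Matrix (Fin n) (Fin n) ℝ := fun t =>
    cfc (fun x => Real.log (1 + t * x)) P + cfc (fun x => Real.log (1 + t * x)) (-Q) with hD
  have hDH : ∀ t, (D t).IsHermitian := fun t =>
    Matrix.IsHermitian.add (cfc_predicate (R := ℝ) (p := IsSelfAdjoint) _ _)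
      (cfc_predicate (R := ℝ) (p := IsSelfAdjoint) _ _)
  set H := L + matrixLog C₁ + matrixLog C₂ with hHdef
  have hH : H.IsHermitian := (hL.add (isHermitian_matrixLog _)).add (isHermitian_matrixLog _)
  have hfD : ∀ᶠ t in 𝓝 (0 : ℝ), f t = (NormedSpace.exp (H + D t)).trace := by
    filter_upwards [hC₁.eventually_matrixLog_add_smul hK₁.isHermitian hcomm₁,
      hC₂.eventually_matrixLog_add_smul hK₂.isHermitian.neg hcomm₂.neg_right] with t h1 h2
    rw [hf, h1.2, sub_eq_add_neg, ← smul_neg, h2.2, mul_neg, ← hPdef, ← hQdef, hHdef]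
    congr 2
    simp only [hD]
    abel
  have hDo : (fun t => D t - (t • (P - Q) + t ^ 2 • -((2 : ℝ)⁻¹ • (P * P + Q * Q))))
      =o[𝓝 0] fun t : ℝ => t ^ 2 := by
    have h := ((cfc_log_one_add_mul_sub_isBigO hP.isHermitian).add
      (cfc_log_one_add_mul_sub_isBigO hQ.isHermitian.neg)).trans_isLittleO
      (isLittleO_pow_pow (show 2 < 3 by norm_num))
    refine h.congr_left fun t => ?_
    simp only [hD, neg_mul_neg]
    module
  have hD0 : D 0 = 0 := by
    simp [hD]
  have hDt : Tendsto D (𝓝 0) (𝓝 0) := by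
    have h1 := (hDo.trans_tendsto (show Tendsto (fun t : ℝ => t ^ 2) (𝓝 0) (𝓝 0) by
      simpa using (continuous_pow 2).tendsto (0 : ℝ)))
    have h2 : Tendsto (fun t : ℝ => t • (P - Q) + t ^ 2 • -((2 : ℝ)⁻¹ • (P * P + Q * Q))) (𝓝 0)
        (𝓝 0) := by
      have : Continuous fun t : ℝ => t • (P - Q) + t ^ 2 • -((2 : ℝ)⁻¹ • (P * P + Q * Q)) := by
        fun_prop
      simpa using this.tendsto 0
    simpa using h1.add h2
  have hf0 : f 0 = (NormedSpace.exp H).trace := by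
    rw [hfD.self_of_nhds, hD0, add_zero]
  constructor
  · let +nondep : NormedAlgebra ℚ (Matrix (Fin n) (Fin n) ℝ) := .restrictScalars ℚ ℝ _
    have he : Continuous fun Y : Matrix (Fin n) (Fin n) ℝ => (NormedSpace.exp (H + Y)).trace :=
      (NormedSpace.exp_continuous.comp (continuous_const.add continuous_id)).matrix_trace
    have h := (he.tendsto 0).comp hDt
    rw [add_zero, ← hf0] at h
    exact h.congr' (hfD.mono fun t ht => ht.symm)
  · intro δ hδ
    set G := NormedSpace.exp ((2 : ℝ)⁻¹ • H) with hGdef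
    have hG : G.IsHermitian := hH.exp_smul _
    have hGG : (G * G).trace = f 0 := by
      rw [hf0, ← pow_two, hGdef, Matrix.exp_smul_pow_two, mul_inv_cancel₀ two_ne_zero, one_smul]
    have hE := exp_sub_isLittleO (D := fun t => (2 : ℝ)⁻¹ • D t) (X := (2 : ℝ)⁻¹ • (P - Q))
      (W := (2 : ℝ)⁻¹ • -((2 : ℝ)⁻¹ • (P * P + Q * Q)))
      ((hDo.const_smul_left (2 : ℝ)⁻¹).congr_left fun t => by
        simp only [Pi.smul_apply]; module)
    have hb := eventually_trace_sq_add_trace_sq_le hE (trace_second_coefficient_nonpos hG hP hQ) hδ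
    have hneg : Tendsto (fun t : ℝ => -t) (𝓝 0) (𝓝 0) := by
      simpa using (continuous_neg.tendsto (0 : ℝ))
    filter_upwards [hb, hfD, hneg.eventually hfD] with t h1 h2 h3
    rw [h2, h3, ← hGG]
    -- Only the values at $\pm t$ are bounded above; the subtracted middle term is exactly
    -- $2\operatorname{tr}G^2$.
    have e1 := hH.trace_exp_add_le (hDH t)
    have e2 := hH.trace_exp_add_le (hDH (-t))
    rw [← hGdef] at e1 e2
    linarith

end TraceExp

end TraceExpLog

theorem mainTheorem11 (n : ℕ) (L C₁ C₂ K₁ K₂ : Matrix (Fin n) (Fin n) ℝ)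
    (hL : L.IsSymm) (hC₁ : C₁.PosDef) (hC₂ : C₂.PosDef)
    (hK₁ : K₁.PosSemidef) (hK₂ : K₂.PosSemidef)
    (hcomm₁ : Commute C₁ K₁) (hcomm₂ : Commute C₂ K₂) :
    ∃ ε : ℝ, 0 < ε ∧
      (∀ z ∈ Set.Ioo (-ε) ε, (C₁ + z • K₁).PosDef ∧ (C₂ - z • K₂).PosDef) ∧
      ConcaveOn ℝ (Set.Ioo (-ε) ε) (fun z : ℝ =>
        (NormedSpace.exp
          (L + matrixLog (C₁ + z • K₁) + matrixLog (C₂ - z • K₂))).trace) := by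
  obtain ⟨ε, hε, h⟩ := Metric.eventually_nhds_iff.1
    (eventually_posDef_pencil hC₁ hC₂ hK₁ hK₂ hcomm₁ hcomm₂)
  have hpos : ∀ z ∈ Set.Ioo (-ε) ε, (C₁ + z • K₁).PosDef ∧ (C₂ - z • K₂).PosDef := fun z hz =>
    h (by rw [Real.dist_eq, sub_zero]; exact abs_lt.2 hz)
  refine ⟨ε, hε, hpos, ?_⟩
  set f : ℝ → ℝ := fun z => (NormedSpace.exp
    (L + matrixLog (C₁ + z • K₁) + matrixLog (C₂ - z • K₂))).trace with hf
  have hloc : ∀ z ∈ Set.Ioo (-ε) ε, ContinuousAt (fun t => f (z + t)) 0 ∧ ∀ δ > 0,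
      ∀ᶠ t in nhds (0 : ℝ), f (z + t) + f (z + -t) - 2 * f (z + 0) ≤ δ * t ^ 2 := fun z hz => by
    -- The pencil based at `z` has the same form: $C_1+zK_1$ and $C_2-zK_2$ still commute with $K_1$
    -- and $K_2$.
    refine trace_exp_local_bound (L := L) (C₁ := C₁ + z • K₁) (C₂ := C₂ - z • K₂) (K₁ := K₁)
      (K₂ := K₂) ?_ (hpos z hz).1 (hpos z hz).2 hK₁ hK₂ ?_ ?_ fun t => ?_
    · rw [Matrix.IsHermitian, Matrix.conjTranspose_eq_transpose_of_trivial, hL.eq]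
    · exact hcomm₁.add_left ((Commute.refl K₁).smul_left z)
    · exact hcomm₂.sub_left ((Commute.refl K₂).smul_left z)
    · simp only [hf, add_smul, add_assoc, sub_sub]
  refine concaveOn_Ioo_of_second_difference_le (fun z hz => ?_) fun z hz δ hδ => ?_
  · have h0 := (hloc z hz).1
    have h1 : ContinuousAt (fun w => f (z + (w - z))) z :=
      ContinuousAt.comp (f := fun w => w - z) (g := fun t => f (z + t)) (by simpa using h0)
        (by fun_prop)
    simpa using h1.continuousWithinAt
  · filter_upwards [(hloc z hz).2 δ hδ] with t ht
    simpa [sub_eq_add_neg] using ht
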